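/- For an infinite set $\mathbb M\subseteq\mathbb N$ and $k\in\mathbb N$, let $[\mathbb M]^k$ be the set of strictly increasing $k$-tuples $\overline n=(n_1,\dots,n_k)$ of elements of $\mathbb M$. Let $(Y,d)$ be a metric space. For a bounded map $f:[\mathbb N]^k\to Y$ and $1\le j\le k$, put $$\operatorname{Lip}_j(f)=\sup\{d(f(\overline n),f(\overline m)) : \overline n,\overline m\in[\mathbb N]^k,\ n_i=m_i \text{ for all } i\ne j,\ n_j<m_j\}.$$ For $p\in(1,\infty)$ and $\lambda>0$, the space $Y$ has property $\lambda$-HFC$_{p,d}$ (resp. $\lambda$-HIC$_{p,d}$) if for every $k\in\mathbb N$ and every bounded map $f:[\mathbb N]^k\to Y$ there is an infinite set $\mathbb M\subseteq\mathbb N$ such that $$d(f(\overline n),f(\overline m))\le\lambda\Big(\sum_{j=1}^k\operatorname{Lip}_j(f)^p\Big)^{1/p}$$ for all $\overline n,\overline m\in[\mathbb M]^k$ (resp. for all $\overline n,\overline m\in[\mathbb M]^k$ with $n_1<m_1<n_2<m_2<\cdots<n_k<m_k$). **Theorem.** Let $p\in(1,\infty)$, let $\lambda\ge 2$, and let $(X_n)_{n\in\mathbb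 N}$ be a sequence of real Banach spaces, each with property $\lambda$-HFC$_{p,d}$ (resp. each with property $\lambda$-HIC$_{p,d}$). Then for every $\varepsilon>0$ the $\ell_p$-sum $\big(\sum_n X_n\big)_{\ell_p}$, that is, the space of sequences $(x_n)$ with $x_n\in X_n$ and $\|(x_n)\|=\big(\sum_n\|x_n\|^p\big)^{1/p}<\infty$, has property $(\lambda+\varepsilon)$-HFC$_{p,d}$ (resp. property $(\lambda+\varepsilon)$-HIC$_{p,d}$). -/

import Mathlib

/-- `[ℕ]^k`: the strictly increasing `k`-tuples of natural numbers. -/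
abbrev IncTuple (k : ℕ) : Type := {n : Fin k → ℕ // StrictMono n}

/-- `[M]^k`: the strictly increasing `k`-tuples with entries in `M`. -/
def incTuplesIn (M : Set ℕ) (k : ℕ) : Set (IncTuple k) :=
  {n | ∀ i, n.1 i ∈ M}

/-- `I_k(M)`: the pairs in `[M]^k × [M]^k` with `n₁ < m₁ < n₂ < m₂ < ⋯ < n_k < m_k`. -/
def interlacedPairs (M : Set ℕ) (k : ℕ) : Set (IncTuple k × IncTuple k) :=
  {q | q.1 ∈ incTuplesIn M k ∧ q.2 ∈ incTuplesIn M k ∧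
    (∀ i, q.1.1 i < q.2.1 i) ∧ (∀ i j, i < j → q.2.1 i < q.1.1 j)}

/-- `H_j(M)`: the pairs in `[M]^k × [M]^k` with `n_i = m_i` for all `i ≠ j` and `n_j < m_j`. -/
def directionPairs (M : Set ℕ) {k : ℕ} (j : Fin k) : Set (IncTuple k × IncTuple k) :=
  {q | q.1 ∈ incTuplesIn M k ∧ q.2 ∈ incTuplesIn M k ∧
    (∀ i, i ≠ j → q.1.1 i = q.2.1 i) ∧ q.1.1 j < q.2.1 j}

/-- `Lip_j(f)`: the supremum of `d(f(n), f(m))` over `(n, m) ∈ H_j(ℕ)`. It is only used for bounded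
`f`, so that it is the supremum of a nonempty bounded set of reals. -/
noncomputable def dirLip {X : Type*} [MetricSpace X] {k : ℕ} (f : IncTuple k → X) (j : Fin k) : ℝ :=
  sSup ((fun q : IncTuple k × IncTuple k => dist (f q.1) (f q.2)) '' directionPairs Set.univ j)

/-- Property `lam`-HFC_{p,d} (Hamming full concentration). -/
def HasHFC (lam p : ℝ) (X : Type*) [MetricSpace X] : Prop :=
  ∀ (k : ℕ) (f : IncTuple k → X), Bornology.IsBounded (Set.range f) →
    ∃ M : Set ℕ, M.Infinite ∧ ∀ n ∈ incTuplesIn M k, ∀ m ∈ incTuplesIn M k,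
      dist (f n) (f m) ≤ lam * (∑ j, dirLip f j ^ p) ^ (1 / p)

/-- Property `lam`-HIC_{p,d} (Hamming interlaced concentration). -/
def HasHIC (lam p : ℝ) (X : Type*) [MetricSpace X] : Prop :=
  ∀ (k : ℕ) (f : IncTuple k → X), Bornology.IsBounded (Set.range f) →
    ∃ M : Set ℕ, M.Infinite ∧ ∀ n m, (n, m) ∈ interlacedPairs M k →
      dist (f n) (f m) ≤ lam * (∑ j, dirLip f j ^ p) ^ (1 / p)

/-! Let `f` be bounded and take iterated limits in n₁, …, n_k along a nonprincipal ultrafilter. The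
limit of ‖f(n)‖^p splits into a part that stays in boundedly many coordinates (`stableEnergy`) and a
part that escapes to infinity. The heart of the proof, `totalEnergy_sub_stableEnergy_add_le`, is
that the escaping energy plus the limiting p-th powers of the variations of the first N coordinates,
summed over all directions, is at most ∑ Lip_j(f)^p.

For one variable this is `escaping_energy_add_le`: f(a) has almost no stable energy beyond some N₁ ≥
N, while for late b the energy that f(b) is losing sits beyond N₁. In f(a) - f(b) that energy and
the variation of the first N coordinates occupy disjoint coordinates, so they add up under Lip^p.
Induction on the number of variables telescopes these estimates.

A Ramsey extraction then turns limits into uniform bounds on an infinite set: coordinate variations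
at most c i j for i < N, and tail energies at most τ, with τ + ∑ c i j ≤ ∑ Lip_j(f)^p + ε.
Concentration in each X_i costs a factor λ^p on the head, and the triangle inequality costs 2^p ≤
λ^p on the tail. The full and interlaced versions differ only in the relation `R` between the tuples
compared. -/

open Filter Topology

/-! ### Iterated ultrafilters and Ramsey extraction -/

/-- The ultrafilter on `k`-tuples obtained by iterating the quantifier of the hyperfilter on `ℕ`. -/
noncomputable def iterHyper : (k : ℕ) → Ultrafilter (Fin k → ℕ)
  | 0 => pure Fin.elim0
  | k + 1 => (hyperfilter ℕ).bind fun a => (iterHyper k).map fun n => (Fin.cons a n : Fin (k + 1) → ℕ)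

theorem eventually_iterHyper_zero {Q : (Fin 0 → ℕ) → Prop} :
    (∀ᶠ n in iterHyper 0, Q n) ↔ Q Fin.elim0 :=
  Iff.rfl

theorem eventually_iterHyper_succ {k : ℕ} {Q : (Fin (k + 1) → ℕ) → Prop} :
    (∀ᶠ n in iterHyper (k + 1), Q n) ↔
      ∀ᶠ a in hyperfilter ℕ, ∀ᶠ n in iterHyper k, Q (Fin.cons a n) :=
  Iff.rfl

theorem eventually_gt_hyperfilter (b : ℕ) : ∀ᶠ a in hyperfilter ℕ, b < a :=
  Nat.hyperfilter_le_atTop (eventually_gt_atTop b)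

theorem eventually_strictMono_and_gt (k : ℕ) (b : ℕ) :
    ∀ᶠ n : Fin k → ℕ in iterHyper k, StrictMono n ∧ ∀ i, b < n i := by
  induction k generalizing b with
  | zero => exact eventually_iterHyper_zero.2 ⟨Subsingleton.strictMono _, fun i => i.elim0⟩
  | succ k ih =>
    rw [eventually_iterHyper_succ]
    filter_upwards [eventually_gt_hyperfilter b] with a ha
    filter_upwards [ih a] with n hn
    refine ⟨Fin.strictMono_cons.2 ⟨hn.2, hn.1⟩, fun i => ?_⟩
    induction i using Fin.cases with
    | zero => simpa using ha
    | succ i => simpa using ha.trans (hn.2 i)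

theorem eventually_strictMono (k : ℕ) : ∀ᶠ n : Fin k → ℕ in iterHyper k, StrictMono n :=
  (eventually_strictMono_and_gt k 0).mono fun _ h => h.1

/-- The last entry is the innermost quantifier, so a condition ignoring it is unaffected. This lets
conditions on `k`-tuples and on `(k + 1)`-tuples be extracted on one common set. -/
theorem eventually_init {k : ℕ} {Q : (Fin k → ℕ) → Prop} (h : ∀ᶠ n in iterHyper k, Q n) :
    ∀ᶠ t : Fin (k + 1) → ℕ in iterHyper (k + 1), Q fun i => t i.castSucc := by
  induction k with
  | zero =>
    refine Eventually.of_forall fun t => ?_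
    rw [Subsingleton.elim (fun i : Fin 0 => t i.castSucc) Fin.elim0]
    exact h
  | succ k ih =>
    rw [eventually_iterHyper_succ] at h ⊢
    filter_upwards [h] with a ha
    filter_upwards [ih ha] with t ht
    convert ht using 1
    funext i
    induction i using Fin.cases with
    | zero => simp
    | succ i => simp

/-- `Q` holds for iterated-almost all tuples, also after prescribing an initial segment of
increasing entries from `F`. -/
def IsExtendable : (k : ℕ) → ((Fin k → ℕ) → Prop) → Finset ℕ → Prop
  | 0, Q, _ => Q Fin.elim0
  | k + 1, Q, F => (∀ᶠ n in iterHyper (k + 1), Q n) ∧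
      ∀ b ∈ F, IsExtendable k (fun n => Q (Fin.cons b n)) (F.filter (b < ·))

theorem isExtendable_empty {k : ℕ} {Q : (Fin k → ℕ) → Prop} (h : ∀ᶠ n in iterHyper k, Q n) :
    IsExtendable k Q ∅ := by
  cases k with
  | zero => exact h
  | succ k => exact ⟨h, by simp⟩

/-- This is the greedy step: finitely many prefixes from `F` impose conditions on the next element,
each holding for almost all `a`, and almost all `a` exceed `F`. -/
theorem IsExtendable.eventually_insert {k : ℕ} {Q : (Fin k → ℕ) → Prop} {F : Finset ℕ}
    (h : IsExtendable k Q F) :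
    ∀ᶠ a in hyperfilter ℕ, IsExtendable k Q (insert a F) := by
  induction k generalizing F with
  | zero => exact Eventually.of_forall fun a => h
  | succ k ih =>
    have h1 : ∀ᶠ a in hyperfilter ℕ, ∀ b ∈ F, b < a ∧
        IsExtendable k (fun n => Q (Fin.cons b n)) (insert a (F.filter (b < ·))) :=
      (Filter.eventually_all_finset F).2 fun b hb =>
        (eventually_gt_hyperfilter b).and (ih (h.2 b hb))
    filter_upwards [h1, eventually_iterHyper_succ.1 h.1] with a ha ha'
    refine ⟨h.1, fun b hb => ?_⟩
    rcases Finset.mem_insert.1 hb with rfl | hb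
    · have : (insert b F).filter (b < ·) = ∅ := by
        refine Finset.filter_eq_empty_iff.2 fun x hx => ?_
        rcases Finset.mem_insert.1 hx with rfl | hx
        · exact lt_irrefl _
        · exact (ha x hx).1.le.not_gt
      rw [this]
      exact isExtendable_empty ha'
    · rw [Finset.filter_insert, if_pos (ha b hb).1]
      exact (ha b hb).2

theorem IsExtendable.apply {k : ℕ} {Q : (Fin k → ℕ) → Prop} {F : Finset ℕ}
    (h : IsExtendable k Q F) {n : Fin k → ℕ} (hn : StrictMono n) (hF : ∀ i, n i ∈ F) : Q n := by
  induction k generalizing F with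
  | zero => rwa [Subsingleton.elim n Fin.elim0]
  | succ k ih =>
    have := ih (h.2 (n 0) (hF 0)) (n := Fin.tail n) (hn.comp (Fin.strictMono_succ))
      fun i => Finset.mem_filter.2 ⟨hF _, hn (Fin.succ_pos i)⟩
    rwa [Fin.cons_self_tail] at this

/-- Ramsey-type extraction: a property of iterated-almost all `k`-tuples holds for all increasing
`k`-tuples of an infinite set. -/
theorem exists_infinite_forall_of_eventually {k : ℕ} {Q : (Fin k → ℕ) → Prop}
    (h : ∀ᶠ n in iterHyper k, Q n) :
    ∃ M : Set ℕ, M.Infinite ∧ ∀ n : Fin k → ℕ, StrictMono n → (∀ i, n i ∈ M) → Q n := by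
  have step : ∀ F : {F : Finset ℕ // IsExtendable k Q F}, ∃ F' : {F : Finset ℕ // IsExtendable k Q F},
      F.1 ⊆ F'.1 ∧ F'.1.card = F.1.card + 1 := by
    rintro ⟨F, hF⟩
    obtain ⟨a, ha, ha'⟩ := (hF.eventually_insert.and
      (eventually_gt_hyperfilter (F.sup id))).exists
    refine ⟨⟨insert a F, ha⟩, Finset.subset_insert _ _, Finset.card_insert_of_notMem fun hmem => ?_⟩
    exact (Finset.le_sup (f := id) hmem).not_gt ha'
  choose next hsub hcard using step
  let G : ℕ → {F : Finset ℕ // IsExtendable k Q F} :=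
    fun r => Nat.rec ⟨∅, isExtendable_empty h⟩ (fun _ F => next F) r
  have hmono : Monotone fun r => (G r).1 := monotone_nat_of_le_succ fun r => hsub (G r)
  have hGcard : ∀ r, (G r).1.card = r := fun r => by
    induction r with
    | zero => rfl
    | succ r ih => exact (hcard (G r)).trans (by rw [ih])
  refine ⟨⋃ r, ((G r).1 : Set ℕ), fun hfin => ?_, fun n hn hM => ?_⟩
  · have : (G (hfin.toFinset.card + 1)).1 ⊆ hfin.toFinset := fun x hx =>
      hfin.mem_toFinset.2 (Set.mem_iUnion.2 ⟨hfin.toFinset.card + 1, hx⟩)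
    have := (hGcard (hfin.toFinset.card + 1)).symm.trans_le (Finset.card_le_card this)
    omega
  · choose r hr using fun i => Set.mem_iUnion.1 (hM i)
    exact (G (Finset.univ.sup r)).2.apply hn fun i =>
      hmono (Finset.le_sup (Finset.mem_univ i)) (hr i)

/-! ### Limits of bounded real functions along ultrafilters -/

/-- The limit of a real function along an ultrafilter. -/
noncomputable def ultraLim {S : Type*} (V : Ultrafilter S) (g : S → ℝ) : ℝ := limUnder (V : Filter S) g

section ultraLim

variable {S : Type*} {V : Ultrafilter S} {g h : S → ℝ} {C : ℝ}

theorem tendsto_ultraLim (hg : ∀ s, g s ∈ Set.Icc 0 C) :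
    Tendsto g V (𝓝 (ultraLim V g)) := by
  obtain ⟨x, -, hx⟩ := isCompact_Icc.ultrafilter_le_nhds (V.map g)
    (le_principal_iff.2 (Eventually.of_forall hg : ∀ᶠ s in V, g s ∈ Set.Icc 0 C))
  exact tendsto_nhds_limUnder ⟨x, hx⟩

theorem ultraLim_mem_Icc (hg : ∀ s, g s ∈ Set.Icc 0 C) : ultraLim V g ∈ Set.Icc 0 C :=
  isClosed_Icc.mem_of_tendsto (tendsto_ultraLim hg) (Eventually.of_forall hg)

theorem ultraLim_mono (hg : ∀ s, g s ∈ Set.Icc 0 C) (hh : ∀ s, h s ∈ Set.Icc 0 C)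
    (hgh : ∀ s, g s ≤ h s) : ultraLim V g ≤ ultraLim V h :=
  le_of_tendsto_of_tendsto' (tendsto_ultraLim hg) (tendsto_ultraLim hh) hgh

theorem eventually_lt_ultraLim_add (hg : ∀ s, g s ∈ Set.Icc 0 C) {η : ℝ} (hη : 0 < η) :
    ∀ᶠ s in V, g s < ultraLim V g + η :=
  (tendsto_ultraLim hg).eventually_lt_const (by linarith)

theorem eventually_ultraLim_sub_lt (hg : ∀ s, g s ∈ Set.Icc 0 C) {η : ℝ} (hη : 0 < η) :
    ∀ᶠ s in V, ultraLim V g - η < g s :=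
  (tendsto_ultraLim hg).eventually_const_lt (by linarith)

theorem ultraLim_iterHyper_zero (g : (Fin 0 → ℕ) → ℝ) :
    ultraLim (iterHyper 0) g = g Fin.elim0 :=
  (tendsto_pure_nhds g Fin.elim0).limUnder_eq

/-- Membership in a closed ball around the joint limit passes to the inner limits, so the joint
limit is the iterated one. -/
theorem ultraLim_iterHyper_succ {k : ℕ} {g : (Fin (k + 1) → ℕ) → ℝ} (hg : ∀ s, g s ∈ Set.Icc 0 C) :
    ultraLim (iterHyper (k + 1)) g =
      ultraLim (hyperfilter ℕ) fun a => ultraLim (iterHyper k) fun n => g (Fin.cons a n) := by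
  have h1 : Tendsto (fun a => ultraLim (iterHyper k) fun n => g (Fin.cons a n)) (hyperfilter ℕ)
      (𝓝 (ultraLim (iterHyper (k + 1)) g)) := by
    refine Metric.nhds_basis_closedBall.tendsto_right_iff.2 fun ε hε => ?_
    have := (tendsto_ultraLim (V := iterHyper (k + 1)) hg).eventually
      (Metric.closedBall_mem_nhds _ hε)
    filter_upwards [eventually_iterHyper_succ.1 this] with a ha
    exact Metric.isClosed_closedBall.mem_of_tendsto (tendsto_ultraLim fun n => hg _) ha
  exact h1.limUnder_eq.symm

end ultraLim

/-! ### Stable energy and escape in one variable -/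

/-- The partial sums `∑ i < N, ‖x i‖ ^ p` of the `p`-th power of an `ℓ_p`-norm. -/
noncomputable def headEnergy (p : ℝ) {X : ℕ → Type*} [∀ n, NormedAddCommGroup (X n)]
    (x : ∀ n, X n) (N : ℕ) : ℝ :=
  ∑ i ∈ Finset.range N, ‖x i‖ ^ p

/-- The limiting energy of a family of vectors which does not escape to infinity. -/
noncomputable def stableEnergy (p : ℝ) {X : ℕ → Type*} [∀ n, NormedAddCommGroup (X n)]
    {S : Type*} (V : Ultrafilter S) (f : S → ∀ n, X n) : ℝ :=
  ⨆ N, ultraLim V fun s => headEnergy p (f s) N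

section headEnergy

variable {p : ℝ} {X : ℕ → Type*} [∀ n, NormedAddCommGroup (X n)] {S : Type*}
  {V : Ultrafilter S} {f : S → ∀ n, X n} {C : ℝ}

theorem headEnergy_nonneg (x : ∀ n, X n) (N : ℕ) : 0 ≤ headEnergy p x N :=
  Finset.sum_nonneg fun _ _ => Real.rpow_nonneg (norm_nonneg _) _

theorem headEnergy_mono (x : ∀ n, X n) : Monotone (headEnergy p x) := fun _ _ h =>
  Finset.sum_le_sum_of_subset_of_nonneg (Finset.range_mono h)
    fun _ _ _ => Real.rpow_nonneg (norm_nonneg _) _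

theorem bddAbove_ultraLim_headEnergy (hf : ∀ s N, headEnergy p (f s) N ≤ C) :
    BddAbove (Set.range fun N => ultraLim V fun s => headEnergy p (f s) N) :=
  ⟨C, by
    rintro _ ⟨N, rfl⟩
    exact (ultraLim_mem_Icc fun s => ⟨headEnergy_nonneg _ _, hf s N⟩).2⟩

theorem ultraLim_le_stableEnergy (hf : ∀ s N, headEnergy p (f s) N ≤ C) (N : ℕ) :
    (ultraLim V fun s => headEnergy p (f s) N) ≤ stableEnergy p V f :=
  le_ciSup (bddAbove_ultraLim_headEnergy hf) N

theorem stableEnergy_mem_Icc (hf : ∀ s N, headEnergy p (f s) N ≤ C) :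
    stableEnergy p V f ∈ Set.Icc 0 C :=
  ⟨(ultraLim_mem_Icc fun s => ⟨headEnergy_nonneg _ _, hf s 0⟩).1.trans
    (ultraLim_le_stableEnergy hf 0),
    ciSup_le fun N => (ultraLim_mem_Icc fun s => ⟨headEnergy_nonneg _ _, hf s N⟩).2⟩

theorem exists_stableEnergy_lt_ultraLim (hf : ∀ s N, headEnergy p (f s) N ≤ C) {η : ℝ}
    (hη : 0 < η) (N₀ : ℕ) :
    ∃ N ≥ N₀, stableEnergy p V f - η < ultraLim V fun s => headEnergy p (f s) N := by
  obtain ⟨N, hN⟩ := exists_lt_of_lt_ciSup (show stableEnergy p V f - η <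
    ⨆ N, ultraLim V fun s => headEnergy p (f s) N from sub_lt_self _ hη)
  refine ⟨max N₀ N, le_max_left _ _, hN.trans_le (ultraLim_mono
    (fun s => ⟨headEnergy_nonneg _ _, hf s _⟩) (fun s => ⟨headEnergy_nonneg _ _, hf s _⟩) fun s => ?_)⟩
  exact headEnergy_mono _ (le_max_right _ _)

/-- Minkowski's inequality on the window `[N₁, N₂)`, where `x` is small and `y` is large. -/
theorem window_energy_le (hp : 1 < p) (x y : ∀ n, X n) {N N₁ N₂ : ℕ} (h₁ : N ≤ N₁) (h₂ : N₁ ≤ N₂) :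
    headEnergy p y N₂ - headEnergy p y N₁ ≤
      ((headEnergy p (x - y) N₂ - headEnergy p (x - y) N) ^ (1 / p) +
        (headEnergy p x N₂ - headEnergy p x N₁) ^ (1 / p)) ^ p := by
  have hp0 : 0 < p := by linarith
  have hIco : ∀ (z : ∀ n, X n), headEnergy p z N₂ - headEnergy p z N₁ =
      ∑ i ∈ Finset.Ico N₁ N₂, ‖z i‖ ^ p := fun z => (Finset.sum_Ico_eq_sub _ h₂).symm
  have hnn : ∀ z : ∀ n, X n, 0 ≤ ∑ i ∈ Finset.Ico N₁ N₂, ‖z i‖ ^ p := fun z =>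
    Finset.sum_nonneg fun _ _ => Real.rpow_nonneg (norm_nonneg _) _
  have hmink := Real.Lp_add_le_of_nonneg (s := Finset.Ico N₁ N₂) hp.le
    (f := fun i => ‖(x - y) i‖) (g := fun i => ‖x i‖) (fun _ _ => norm_nonneg _)
    (fun _ _ => norm_nonneg _)
  have hle : ∑ i ∈ Finset.Ico N₁ N₂, ‖y i‖ ^ p ≤
      ∑ i ∈ Finset.Ico N₁ N₂, (‖(x - y) i‖ + ‖x i‖) ^ p := by
    refine Finset.sum_le_sum fun i _ => Real.rpow_le_rpow (norm_nonneg _) ?_ hp0.le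
    have := norm_sub_le (x i) (x i - y i)
    rw [sub_sub_cancel] at this
    simpa [add_comm] using this
  have hdiff : ∑ i ∈ Finset.Ico N₁ N₂, ‖(x - y) i‖ ^ p ≤
      headEnergy p (x - y) N₂ - headEnergy p (x - y) N := by
    rw [← hIco]
    linarith [headEnergy_mono (p := p) (x - y) h₁]
  rw [hIco y, hIco x]
  calc ∑ i ∈ Finset.Ico N₁ N₂, ‖y i‖ ^ p
      ≤ ((∑ i ∈ Finset.Ico N₁ N₂, (‖(x - y) i‖ + ‖x i‖) ^ p) ^ (1 / p)) ^ p := by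
        rw [one_div, Real.rpow_inv_rpow ((hnn y).trans hle) hp0.ne']
        exact hle
    _ ≤ _ := by
        have h0 : 0 ≤ 1 / p := by positivity
        have := Real.rpow_le_rpow (hnn (x - y)) hdiff h0
        refine Real.rpow_le_rpow (Real.rpow_nonneg ((hnn y).trans hle) _) ?_ hp0.le
        linarith

/-- Let η decrease to 0. The multiples 3η and 5η are the errors accumulated in
`escaping_energy_add_le`. -/
theorem le_of_forall_minkowski_perturbation (hp : 1 < p) {A B : ℝ}
    (h : ∀ η > 0, 0 ≤ B + 3 * η ∧ A - 5 * η ≤ ((B + 3 * η) ^ (1 / p) + (3 * η) ^ (1 / p)) ^ p) :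
    A ≤ B := by
  have hp0 : 0 < p := by linarith
  have hp1 : 0 < 1 / p := by positivity
  have hB : 0 ≤ B := le_of_forall_pos_le_add fun ε hε => by
    have := (h (ε / 3) (by positivity)).1
    linarith
  have hc : Continuous fun η : ℝ => ((B + 3 * η) ^ (1 / p) + (3 * η) ^ (1 / p)) ^ p := by
    refine Continuous.rpow_const (Continuous.add ?_ ?_) fun _ => Or.inr hp0.le
    · exact Continuous.rpow_const (by fun_prop) fun _ => Or.inr hp1.le
    · exact Continuous.rpow_const (by fun_prop) fun _ => Or.inr hp1.le
  have h1 : Tendsto (fun η : ℝ => ((B + 3 * η) ^ (1 / p) + (3 * η) ^ (1 / p)) ^ p) (𝓝[>] 0)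
      (𝓝 B) := by
    have := (hc.tendsto 0).mono_left (nhdsWithin_le_nhds (s := Set.Ioi 0))
    simpa only [mul_zero, add_zero, Real.zero_rpow (inv_ne_zero hp0.ne'), one_div,
      Real.rpow_inv_rpow hB hp0.ne'] using this
  have h2 : Tendsto (fun η : ℝ => A - 5 * η) (𝓝[>] 0) (𝓝 A) := by
    have := ((by fun_prop : Continuous fun η : ℝ => A - 5 * η).tendsto 0).mono_left
      (nhdsWithin_le_nhds (s := Set.Ioi 0))
    simpa using this
  exact le_of_tendsto_of_tendsto h2 h1 (eventually_mem_nhdsWithin.mono fun η hη => (h η hη).2)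

/-- The energy escaping to infinity in one variable, together with the limiting energy of the
differences in the first `N` coordinates, is controlled by the Lipschitz bound in this variable. -/
theorem escaping_energy_add_le (hp : 1 < p) {U : Ultrafilter ℕ} {f : ℕ → S → ∀ n, X n}
    (hf : ∀ a s N, headEnergy p (f a s) N ≤ C)
    (hd : ∀ a b s N, headEnergy p (f a s - f b s) N ≤ C) {K : ℝ}
    (hK : ∀ᶠ a in U, ∀ᶠ b in U, ∀ᶠ s in V, ∀ N, headEnergy p (f a s - f b s) N ≤ K) (N : ℕ) :
    (ultraLim U fun a => stableEnergy p V (f a)) -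
      (⨆ M, ultraLim U fun a => ultraLim V fun s => headEnergy p (f a s) M) +
      (ultraLim U fun a => ultraLim U fun b => ultraLim V fun s => headEnergy p (f a s - f b s) N)
      ≤ K := by
  set G := ultraLim U fun a => stableEnergy p V (f a)
  set D := ⨆ M, ultraLim U fun a => ultraLim V fun s => headEnergy p (f a s) M
  set c := ultraLim U fun a => ultraLim U fun b => ultraLim V fun s => headEnergy p (f a s - f b s) N
  have bf : ∀ a N s, headEnergy p (f a s) N ∈ Set.Icc 0 C := fun a N s =>
    ⟨headEnergy_nonneg _ _, hf a s N⟩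
  have bd : ∀ a b s, headEnergy p (f a s - f b s) N ∈ Set.Icc 0 C := fun a b s =>
    ⟨headEnergy_nonneg _ _, hd a b s N⟩
  have bG : ∀ a, stableEnergy p V (f a) ∈ Set.Icc 0 C := fun a => stableEnergy_mem_Icc (hf a)
  have bH : ∀ N a, (ultraLim V fun s => headEnergy p (f a s) N) ∈ Set.Icc 0 C := fun N a =>
    ultraLim_mem_Icc (bf a N)
  have bc : ∀ a b, (ultraLim V fun s => headEnergy p (f a s - f b s) N) ∈ Set.Icc 0 C := fun a b =>
    ultraLim_mem_Icc (bd a b)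
  have bc' : ∀ a, (ultraLim U fun b => ultraLim V fun s => headEnergy p (f a s - f b s) N) ∈
      Set.Icc 0 C := fun a => ultraLim_mem_Icc (bc a)
  have hD : ∀ M, (ultraLim U fun a => ultraLim V fun s => headEnergy p (f a s) M) ≤ D := fun M =>
    le_ciSup (f := fun M => ultraLim U fun a => ultraLim V fun s => headEnergy p (f a s) M)
      ⟨C, by rintro _ ⟨N, rfl⟩; exact (ultraLim_mem_Icc (bH N)).2⟩ M
  suffices G - D ≤ K - c by linarith
  refine le_of_forall_minkowski_perturbation hp fun η hη => ?_
  -- The order of choice matters: `a`, then `N₁` capturing the stable energy of `f a`, then a late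
  -- `b`, then `N₂` for `f b`, and finally `s`.
  obtain ⟨a, ha, hca⟩ := (hK.and (eventually_ultraLim_sub_lt bc' hη)).exists
  obtain ⟨N₁, hN₁, hGa⟩ := exists_stableEnergy_lt_ultraLim (V := V) (hf a) hη N
  obtain ⟨b, hb, hGb, hDb, hcb⟩ := (ha.and ((eventually_ultraLim_sub_lt bG hη).and
    ((eventually_lt_ultraLim_add (bH N₁) hη).and (eventually_ultraLim_sub_lt (bc a) hη)))).exists
  obtain ⟨N₂, hN₂, hGb'⟩ := exists_stableEnergy_lt_ultraLim (V := V) (hf b) hη N₁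
  obtain ⟨s, hs, h1, h2, h3, h4, h5⟩ := (hb.and ((eventually_lt_ultraLim_add (bf a N₂) hη).and
    ((eventually_ultraLim_sub_lt (bf a N₁) hη).and ((eventually_lt_ultraLim_add (bf b N₁) hη).and
    ((eventually_ultraLim_sub_lt (bf b N₂) hη).and
      (eventually_ultraLim_sub_lt (bd a b) hη)))))).exists
  have h6 := ultraLim_le_stableEnergy (V := V) (hf a) N₂
  have h7 := hD N₁
  have h8 := hs N₂
  have h9 : headEnergy p (f a s - f b s) N ≤ headEnergy p (f a s - f b s) N₂ :=
    headEnergy_mono _ (hN₁.trans hN₂)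
  have h10 : headEnergy p (f a s) N₁ ≤ headEnergy p (f a s) N₂ := headEnergy_mono _ hN₂
  refine ⟨by linarith, ?_⟩
  -- Up to `N₂` the vector `f b s` has energy above G - 3η, up to `N₁` below D + 2η.
  calc G - D - 5 * η ≤ headEnergy p (f b s) N₂ - headEnergy p (f b s) N₁ := by linarith
    _ ≤ _ := window_energy_le hp (f a s) (f b s) hN₁ hN₂
    _ ≤ _ := by
      have hp1 : 0 ≤ 1 / p := by positivity
      -- The difference has energy at most K up to `N₂` and above c - 3η up to `N`, while `f a s`
      -- has less than 3η on the window.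
      have e1 := Real.rpow_le_rpow (sub_nonneg.2 h9)
        (show _ ≤ K - c + 3 * η by linarith) hp1
      have e2 := Real.rpow_le_rpow (sub_nonneg.2 h10)
        (show _ ≤ 3 * η by linarith) hp1
      exact Real.rpow_le_rpow (add_nonneg (Real.rpow_nonneg (sub_nonneg.2 h9) _)
        (Real.rpow_nonneg (sub_nonneg.2 h10) _)) (add_le_add e1 e2) (by linarith)

end headEnergy

/-! ### Escape in all variables -/

/-- The `p`-th power of the `ℓ_p`-norm, as the supremum of the partial sums. -/
noncomputable def totalEnergy (p : ℝ) {X : ℕ → Type*} [∀ n, NormedAddCommGroup (X n)]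
    (x : ∀ n, X n) : ℝ :=
  ⨆ N, headEnergy p x N

/-- The energy in the first `N` coordinates of the variation of `f` in direction `j`: the entries
`t j` and `t (j + 1)` are the two values of the `j`-th variable. -/
noncomputable def variationEnergy (p : ℝ) {X : ℕ → Type*} [∀ n, NormedAddCommGroup (X n)] {k : ℕ}
    (f : (Fin k → ℕ) → ∀ n, X n) (j : Fin k) (N : ℕ) (t : Fin (k + 1) → ℕ) : ℝ :=
  headEnergy p (f (j.succ.removeNth t) - f (j.castSucc.removeNth t)) N

theorem removeNth_succ_cons {α : Type*} {k : ℕ} (i : Fin (k + 1)) (a : α) (t : Fin (k + 1) → α) :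
    i.succ.removeNth (Fin.cons a t : Fin (k + 2) → α) =
      (Fin.cons a (i.removeNth t) : Fin (k + 1) → α) :=
  Fin.cons_comp_succ_succAbove a t i

section energy

variable {p : ℝ} {X : ℕ → Type*} [∀ n, NormedAddCommGroup (X n)] {C : ℝ}

theorem totalEnergy_mem_Icc {x : ∀ n, X n} (hx : ∀ N, headEnergy p x N ≤ C) :
    totalEnergy p x ∈ Set.Icc 0 C :=
  ⟨(headEnergy_nonneg x 0).trans (le_ciSup (f := headEnergy p x)
    ⟨C, by rintro _ ⟨N, rfl⟩; exact hx N⟩ 0), ciSup_le hx⟩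

theorem variationEnergy_cons_succ {k : ℕ} (f : (Fin (k + 1) → ℕ) → ∀ n, X n) (j : Fin k) (N a : ℕ)
    (t : Fin (k + 1) → ℕ) :
    variationEnergy p f j.succ N (Fin.cons a t) =
      variationEnergy p (fun n => f (Fin.cons a n)) j N t := by
  simp only [variationEnergy, removeNth_succ_cons, Fin.castSucc_succ]

theorem variationEnergy_cons_cons_zero {k : ℕ} (f : (Fin (k + 1) → ℕ) → ∀ n, X n) (N a b : ℕ)
    (n : Fin k → ℕ) :
    variationEnergy p f 0 N (Fin.cons a (Fin.cons b n)) =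
      headEnergy p (f (Fin.cons a n) - f (Fin.cons b n)) N := by
  simp only [variationEnergy, removeNth_succ_cons, Fin.castSucc_zero, Fin.removeNth_zero,
    Fin.tail_cons]

theorem stableEnergy_iterHyper_succ {k : ℕ} {f : (Fin (k + 1) → ℕ) → ∀ n, X n}
    (hf : ∀ s N, headEnergy p (f s) N ≤ C) :
    stableEnergy p (iterHyper (k + 1)) f =
      ⨆ M, ultraLim (hyperfilter ℕ) fun a =>
        ultraLim (iterHyper k) fun n => headEnergy p (f (Fin.cons a n)) M :=
  iSup_congr fun M => ultraLim_iterHyper_succ fun s => ⟨headEnergy_nonneg _ _, hf s M⟩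

/-- All the energy escaping to infinity, together with the limiting variations in the first `N`
coordinates, is controlled by the Lipschitz bounds in the different directions. -/
theorem totalEnergy_sub_stableEnergy_add_le (hp : 1 < p) {k : ℕ} {f : (Fin k → ℕ) → ∀ n, X n}
    (hf : ∀ s N, headEnergy p (f s) N ≤ C) (hd : ∀ s t N, headEnergy p (f s - f t) N ≤ C)
    {K : Fin k → ℝ}
    (hK : ∀ j, ∀ᶠ t in iterHyper (k + 1), ∀ N, variationEnergy p f j N t ≤ K j) (N : ℕ) :
    (ultraLim (iterHyper k) fun n => totalEnergy p (f n)) - stableEnergy p (iterHyper k) f +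
      ∑ j, ultraLim (iterHyper (k + 1)) (variationEnergy p f j N) ≤ ∑ j, K j := by
  induction k with
  | zero => simp [ultraLim_iterHyper_zero, stableEnergy, totalEnergy]
  | succ k ih =>
    have bT : ∀ s, totalEnergy p (f s) ∈ Set.Icc 0 C := fun s => totalEnergy_mem_Icc (hf s)
    have bv : ∀ j t, variationEnergy p f j N t ∈ Set.Icc 0 C := fun j t =>
      ⟨headEnergy_nonneg _ _, hd _ _ _⟩
    have bv' : ∀ a j t, variationEnergy p (fun n => f (Fin.cons a n)) j N t ∈ Set.Icc 0 C :=
      fun a j t => ⟨headEnergy_nonneg _ _, hd _ _ _⟩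
    have hbig : ∀ᶠ a in hyperfilter ℕ,
        (ultraLim (iterHyper k) fun n => totalEnergy p (f (Fin.cons a n))) -
          stableEnergy p (iterHyper k) (fun n => f (Fin.cons a n)) +
          ∑ j, ultraLim (iterHyper (k + 1)) (variationEnergy p (fun n => f (Fin.cons a n)) j N) ≤
        ∑ j : Fin k, K j.succ := by
      have h := eventually_all.2 fun j : Fin k => eventually_iterHyper_succ.1 (hK j.succ)
      filter_upwards [h] with a ha
      refine ih (fun s => hf _) (fun s t => hd _ _) fun j => ?_
      filter_upwards [ha j] with t ht M
      rw [← variationEnergy_cons_succ]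
      exact ht M
    -- The induction hypothesis for the slices `f (Fin.cons a ·)` is passed to the limit in `a`;
    -- `h2` handles the first variable.
    have h1 := le_of_tendsto (((tendsto_ultraLim (V := hyperfilter ℕ) fun a =>
      ultraLim_mem_Icc (V := iterHyper k) fun n => bT (Fin.cons a n)).sub
        (tendsto_ultraLim fun a => stableEnergy_mem_Icc (V := iterHyper k)
          (f := fun n => f (Fin.cons a n)) fun s => hf _)).add
        (tendsto_finsetSum Finset.univ fun j _ => tendsto_ultraLim fun a =>
          ultraLim_mem_Icc (V := iterHyper (k + 1)) (bv' a j))) hbig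
    have h2 : (ultraLim (hyperfilter ℕ) fun a => stableEnergy p (iterHyper k) fun n =>
        f (Fin.cons a n)) - stableEnergy p (iterHyper (k + 1)) f +
        ultraLim (iterHyper (k + 1 + 1)) (variationEnergy p f 0 N) ≤ K 0 := by
      rw [stableEnergy_iterHyper_succ hf, ultraLim_iterHyper_succ (bv 0)]
      have e : ∀ a, (ultraLim (iterHyper (k + 1)) fun n => variationEnergy p f 0 N (Fin.cons a n)) =
          ultraLim (hyperfilter ℕ) fun b => ultraLim (iterHyper k) fun n =>
            headEnergy p (f (Fin.cons a n) - f (Fin.cons b n)) N := fun a => by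
        rw [ultraLim_iterHyper_succ fun s => bv 0 _]
        simp only [variationEnergy_cons_cons_zero]
      simp only [e]
      refine escaping_energy_add_le hp (f := fun a n => f (Fin.cons a n)) (fun a s => hf _)
        (fun a b s => hd _ _) ?_ N
      filter_upwards [eventually_iterHyper_succ.1 (hK 0)] with a ha
      filter_upwards [eventually_iterHyper_succ.1 ha] with b hb
      filter_upwards [hb] with n hn M
      rw [← variationEnergy_cons_cons_zero]
      exact hn M
    have h3 : ∀ j : Fin k, ultraLim (iterHyper (k + 1 + 1)) (variationEnergy p f j.succ N) =
        ultraLim (hyperfilter ℕ) fun a => ultraLim (iterHyper (k + 1))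
          (variationEnergy p (fun n => f (Fin.cons a n)) j N) := fun j => by
      rw [ultraLim_iterHyper_succ (bv j.succ)]
      simp only [variationEnergy_cons_succ]
    rw [Fin.sum_univ_succ, Fin.sum_univ_succ, ultraLim_iterHyper_succ bT]
    simp only [h3]
    -- The limit of the stable energies of the slices occurs with opposite signs in `h1` and `h2`
    -- and cancels.
    linarith

end energy

/-! ### Direction pairs as tuples with one more entry -/

theorem removeNth_succ_self_eq {k : ℕ} (j : Fin k) (t : Fin (k + 1) → ℕ) :
    j.succ.removeNth t j = t j.castSucc ∧ j.castSucc.removeNth t j = t j.succ := by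
  simp [Fin.removeNth]

theorem removeNth_succ_eq_of_ne {k : ℕ} {i j : Fin k} (h : i ≠ j) (t : Fin (k + 1) → ℕ) :
    j.succ.removeNth t i = j.castSucc.removeNth t i := by
  rcases lt_or_gt_of_ne h with h | h
  · simp only [Fin.removeNth]
    rw [Fin.succAbove_of_castSucc_lt _ _ (Fin.castSucc_lt_castSucc_iff.2 h),
      Fin.succAbove_of_castSucc_lt _ _ ((Fin.castSucc_lt_castSucc_iff.2 h).trans j.castSucc_lt_succ)]
  · simp only [Fin.removeNth]
    rw [Fin.succAbove_of_le_castSucc _ _ (Fin.castSucc_le_castSucc_iff.2 h.le),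
      Fin.succAbove_of_le_castSucc]
    exact Fin.succ_le_castSucc_iff.2 h

/-- The pair of `k`-tuples obtained from a `(k + 1)`-tuple by deleting one of two consecutive
entries. -/
theorem removeNth_mem_directionPairs {k : ℕ} (j : Fin k) {t : Fin (k + 1) → ℕ} (ht : StrictMono t) :
    ((⟨j.succ.removeNth t, ht.comp (Fin.strictMono_succAbove _)⟩,
      ⟨j.castSucc.removeNth t, ht.comp (Fin.strictMono_succAbove _)⟩) : IncTuple k × IncTuple k) ∈
      directionPairs Set.univ j := by
  refine ⟨fun _ => Set.mem_univ _, fun _ => Set.mem_univ _,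
    fun i hi => removeNth_succ_eq_of_ne hi t, ?_⟩
  change j.succ.removeNth t j < j.castSucc.removeNth t j
  rw [(removeNth_succ_self_eq j t).1, (removeNth_succ_self_eq j t).2]
  exact ht j.castSucc_lt_succ

/-- Insert m_j directly after n_j; the result increases because n_j < m_j < m_{j+1} = n_{j+1}. -/
theorem exists_removeNth_eq_of_mem_directionPairs {M : Set ℕ} {k : ℕ} {j : Fin k}
    {n m : IncTuple k} (h : (n, m) ∈ directionPairs M j) :
    ∃ t : Fin (k + 1) → ℕ, StrictMono t ∧ (∀ i, t i ∈ M) ∧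
      j.succ.removeNth t = n.1 ∧ j.castSucc.removeNth t = m.1 := by
  obtain ⟨hn, hm, heq, hlt⟩ := h
  have h1 : j.succ.removeNth (j.succ.insertNth (α := fun _ => ℕ) (m.1 j) n.1) = n.1 :=
    Fin.removeNth_insertNth _ _ _
  have h2 : j.castSucc.removeNth (j.succ.insertNth (α := fun _ => ℕ) (m.1 j) n.1) = m.1 := by
    funext i
    by_cases hi : i = j
    · subst hi
      rw [(removeNth_succ_self_eq _ _).2, Fin.insertNth_apply_same]
    · rw [← removeNth_succ_eq_of_ne hi, h1, heq i hi]
  refine ⟨j.succ.insertNth (α := fun _ => ℕ) (m.1 j) n.1, ?_, fun i => ?_, h1, h2⟩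
  · rw [Fin.strictMono_insertNth_iff]
    refine ⟨n.2, fun i hi => ?_, fun i hi => ?_⟩
    · rw [Fin.castSucc_lt_succ_iff] at hi
      exact (n.2.monotone hi).trans_lt hlt
    · have hi' : j < i := by simpa [Fin.succ_le_castSucc_iff] using hi
      rw [heq i hi'.ne']
      exact m.2 hi'
  · rcases Fin.eq_self_or_eq_succAbove j.succ i with rfl | ⟨l, rfl⟩
    · rw [Fin.insertNth_apply_same]; exact hm j
    · rw [Fin.insertNth_apply_succAbove]; exact hn l

/-- The image of an increasing tuple under a strictly increasing map. -/
def IncTuple.comp {k : ℕ} {e : ℕ → ℕ} (he : StrictMono e) (n : IncTuple k) : IncTuple k :=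
  ⟨e ∘ n.1, he.comp n.2⟩

theorem exists_comp_eq_of_mem_incTuplesIn {k : ℕ} {e : ℕ → ℕ} (he : StrictMono e) {M : Set ℕ}
    {n : IncTuple k} (hn : n ∈ incTuplesIn (e '' M) k) :
    ∃ n₀ ∈ incTuplesIn M k, n = IncTuple.comp he n₀ := by
  choose n₀ h₀ h₁ using hn
  refine ⟨⟨n₀, fun i j hij => ?_⟩, h₀, Subtype.ext (funext fun i => (h₁ i).symm)⟩
  rw [← he.lt_iff_lt, h₁, h₁]
  exact n.2 hij

/-! ### Directional Lipschitz constants -/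

section dirLip

variable {Y : Type*} [MetricSpace Y] {k : ℕ} {f : IncTuple k → Y}

theorem dirLip_nonneg (f : IncTuple k → Y) (j : Fin k) : 0 ≤ dirLip f j :=
  Real.sSup_nonneg (by rintro _ ⟨q, -, rfl⟩; exact dist_nonneg)

theorem dist_le_dirLip (hf : Bornology.IsBounded (Set.range f)) {j : Fin k} {n m : IncTuple k}
    (h : (n, m) ∈ directionPairs Set.univ j) : dist (f n) (f m) ≤ dirLip f j := by
  obtain ⟨C, hC⟩ := Metric.isBounded_iff.1 hf
  refine le_csSup ⟨C, ?_⟩ ⟨(n, m), h, rfl⟩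
  rintro _ ⟨q, -, rfl⟩
  exact hC ⟨_, rfl⟩ ⟨_, rfl⟩

/-- If `f` does not vary in any direction, then it is constant. -/
theorem eq_of_forall_dirLip_eq_zero (hf : Bornology.IsBounded (Set.range f))
    (h : ∀ j, dirLip f j = 0) (n m : IncTuple k) : f n = f m := by
  have key : ∀ n m : IncTuple k, (∀ i j, n.1 i < m.1 j) → f n = f m := by
    intro n m hnm
    -- Hybrid tuples: the first `r` entries from `n`, the others from `m`. Consecutive ones differ
    -- in a single entry.
    let H : ℕ → IncTuple k := fun r => ⟨fun i => if (i : ℕ) < r then n.1 i else m.1 i, by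
      intro i j hij
      have hij' : (i : ℕ) < j := hij
      have h1 := n.2 hij
      have h2 := m.2 hij
      have h3 := hnm i j
      dsimp only
      split_ifs <;> first | assumption | omega⟩
    have h0 : H 0 = m := Subtype.ext (funext fun i => by simp [H])
    have hk : H k = n := Subtype.ext (funext fun i => by simp [H])
    have hstep : ∀ r, r < k → f (H (r + 1)) = f (H r) := by
      intro r hr
      refine dist_le_zero.1 ((dist_le_dirLip hf (j := ⟨r, hr⟩)
        ⟨fun _ => Set.mem_univ _, fun _ => Set.mem_univ _, fun i hi => ?_, ?_⟩).trans_eq (h _))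
      · have : (i : ℕ) ≠ r := fun e => hi (Fin.ext e)
        simp only [H]
        split_ifs <;> first | rfl | omega
      · simpa [H] using hnm _ _
    have : ∀ r, r ≤ k → f (H r) = f (H 0) := by
      intro r
      induction r with
      | zero => exact fun _ => rfl
      | succ r ih => exact fun hr => (hstep r hr).trans (ih (by omega))
    rw [← hk, ← h0]
    exact this k le_rfl
  -- Arbitrary `n` and `m` are compared through a tuple `l` lying beyond both.
  let b := (Finset.univ.sup n.1) + (Finset.univ.sup m.1) + 1
  let l : IncTuple k := ⟨fun i => b + i, fun i j hij => Nat.add_lt_add_left hij b⟩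
  have hn : ∀ i, n.1 i ≤ Finset.univ.sup n.1 := fun i => Finset.le_sup (Finset.mem_univ i)
  have hm : ∀ i, m.1 i ≤ Finset.univ.sup m.1 := fun i => Finset.le_sup (Finset.mem_univ i)
  refine (key n l fun i j => ?_).trans (key m l fun i j => ?_).symm
  · have := hn i
    simp only [l, b]
    omega
  · have := hm i
    simp only [l, b]
    omega

end dirLip

/-! ### A common framework for full and interlaced concentration -/

/-- Hamming concentration for the pairs of tuples related by `R`. -/
def HasConcentration (R : ∀ k, IncTuple k → IncTuple k → Prop) (lam p : ℝ) (Y : Type*)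
    [MetricSpace Y] : Prop :=
  ∀ (k : ℕ) (f : IncTuple k → Y), Bornology.IsBounded (Set.range f) →
    ∃ M : Set ℕ, M.Infinite ∧ ∀ n ∈ incTuplesIn M k, ∀ m ∈ incTuplesIn M k, R k n m →
      dist (f n) (f m) ≤ lam * (∑ j, dirLip f j ^ p) ^ (1 / p)

/-- `R` only depends on the relative order of the entries of the two tuples. -/
def IsReindexInvariant (R : ∀ k, IncTuple k → IncTuple k → Prop) : Prop :=
  ∀ ⦃e : ℕ → ℕ⦄ (he : StrictMono e) (k : ℕ) (n m : IncTuple k),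
    R k (n.comp he) (m.comp he) → R k n m

theorem hasHFC_iff_hasConcentration {lam p : ℝ} {Y : Type*} [MetricSpace Y] :
    HasHFC lam p Y ↔ HasConcentration (fun _ _ _ => True) lam p Y := by
  simp only [HasHFC, HasConcentration, true_implies]

/-- The strict interlacing `n₁ < m₁ < n₂ < m₂ < ⋯` of two tuples. -/
def Interlaced (k : ℕ) (n m : IncTuple k) : Prop :=
  (∀ i, n.1 i < m.1 i) ∧ ∀ i j, i < j → m.1 i < n.1 j

theorem isReindexInvariant_interlaced : IsReindexInvariant Interlaced := fun _ he _ _ _ h =>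
  ⟨fun i => he.lt_iff_lt.1 (h.1 i), fun i j hij => he.lt_iff_lt.1 (h.2 i j hij)⟩

theorem hasHIC_iff_hasConcentration {lam p : ℝ} {Y : Type*} [MetricSpace Y] :
    HasHIC lam p Y ↔ HasConcentration Interlaced lam p Y :=
  forall₃_congr fun _ _ _ => exists_congr fun _ => and_congr_right fun _ =>
    ⟨fun h n hn m hm hR => h n m ⟨hn, hm, hR.1, hR.2⟩,
      fun h n m hnm => h n hnm.1 m hnm.2.1 ⟨hnm.2.2.1, hnm.2.2.2⟩⟩

/-- Reindexing by the increasing enumeration of `M` means that only variations within `M` matter.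
This local form can be iterated over finitely many coordinates. -/
theorem HasConcentration.exists_infinite_subset {R : ∀ k, IncTuple k → IncTuple k → Prop}
    (hR : IsReindexInvariant R) {lam p : ℝ} (hlam : 0 ≤ lam) (hp : 0 < p) {Y : Type*}
    [MetricSpace Y] (hY : HasConcentration R lam p Y) {k : ℕ} {f : IncTuple k → Y}
    (hf : Bornology.IsBounded (Set.range f)) {M : Set ℕ} (hM : M.Infinite) {b : Fin k → ℝ}
    (hb0 : ∀ j, 0 ≤ b j)
    (hb : ∀ j n m, (n, m) ∈ directionPairs M j → dist (f n) (f m) ≤ b j) :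
    ∃ M' ⊆ M, M'.Infinite ∧ ∀ n ∈ incTuplesIn M' k, ∀ m ∈ incTuplesIn M' k, R k n m →
      dist (f n) (f m) ≤ lam * (∑ j, b j ^ p) ^ (1 / p) := by
  have he : StrictMono (Nat.nth (· ∈ M)) := Nat.nth_strictMono hM
  have heM : ∀ i, Nat.nth (· ∈ M) i ∈ M := Nat.nth_mem_of_infinite hM
  obtain ⟨M₀, hM₀, h⟩ := hY k (fun n => f (n.comp he))
    (hf.subset (by rintro _ ⟨n, rfl⟩; exact ⟨_, rfl⟩))
  refine ⟨Nat.nth (· ∈ M) '' M₀, by rintro _ ⟨i, -, rfl⟩; exact heM i,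
    hM₀.image he.injective.injOn, fun n hn m hm hnm => ?_⟩
  obtain ⟨n₀, hn₀, rfl⟩ := exists_comp_eq_of_mem_incTuplesIn he hn
  obtain ⟨m₀, hm₀, rfl⟩ := exists_comp_eq_of_mem_incTuplesIn he hm
  refine (h n₀ hn₀ m₀ hm₀ (hR he k _ _ hnm)).trans (mul_le_mul_of_nonneg_left ?_ hlam)
  refine Real.rpow_le_rpow
    (Finset.sum_nonneg fun j _ => Real.rpow_nonneg (dirLip_nonneg _ j) _)
    (Finset.sum_le_sum fun j _ => Real.rpow_le_rpow (dirLip_nonneg _ j) ?_ hp.le) (by positivity)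
  refine Real.sSup_le ?_ (hb0 j)
  rintro _ ⟨⟨n, m⟩, ⟨-, -, heq, hlt⟩, rfl⟩
  exact hb j _ _ ⟨fun i => heM _, fun i => heM _, fun i hi => congrArg (Nat.nth (· ∈ M)) (heq i hi), he hlt⟩

/-! ### Head and tail estimates in the ℓ_p-sum -/

theorem rpow_norm_sub_le {E : Type*} [SeminormedAddCommGroup E] {p : ℝ} (hp : 1 ≤ p) (x y : E) :
    ‖x - y‖ ^ p ≤ 2 ^ (p - 1) * (‖x‖ ^ p + ‖y‖ ^ p) :=
  (Real.rpow_le_rpow (norm_nonneg _) (norm_sub_le x y) (by linarith)).trans <| by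
    exact_mod_cast NNReal.rpow_add_le_mul_rpow_add_rpow ‖x‖₊ ‖y‖₊ hp

section lpSum

variable {p : ℝ} {X : ℕ → Type*} [∀ n, NormedAddCommGroup (X n)]

theorem hasSum_rpow_norm (hp : 0 < p) (x : lp X (ENNReal.ofReal p)) :
    HasSum (fun i => ‖x i‖ ^ p) (‖x‖ ^ p) := by
  have h : (ENNReal.ofReal p).toReal = p := ENNReal.toReal_ofReal hp.le
  simpa only [h] using lp.hasSum_norm (h.symm ▸ hp) x

theorem headEnergy_le_rpow_norm (hp : 0 < p) (x : lp X (ENNReal.ofReal p)) (N : ℕ) :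
    headEnergy p x N ≤ ‖x‖ ^ p :=
  sum_le_hasSum _ (fun _ _ => Real.rpow_nonneg (norm_nonneg _) _) (hasSum_rpow_norm hp x)

theorem totalEnergy_eq_rpow_norm (hp : 0 < p) (x : lp X (ENNReal.ofReal p)) :
    totalEnergy p x = ‖x‖ ^ p :=
  tendsto_nhds_unique (tendsto_atTop_ciSup (headEnergy_mono _)
    ⟨‖x‖ ^ p, by rintro _ ⟨N, rfl⟩; exact headEnergy_le_rpow_norm hp x N⟩)
    (hasSum_rpow_norm hp x).tendsto_sum_nat

/-- The `p`-th power of the norm of a difference, where only the tail beyond `N` is estimated by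
the triangle inequality. -/
theorem rpow_norm_sub_le_headEnergy_add (hp : 1 ≤ p) (x y : lp X (ENNReal.ofReal p)) (N : ℕ) {τ : ℝ}
    (hx : ‖x‖ ^ p - headEnergy p x N ≤ τ) (hy : ‖y‖ ^ p - headEnergy p y N ≤ τ) :
    ‖x - y‖ ^ p ≤ headEnergy p (x - y : lp X (ENNReal.ofReal p)) N + 2 ^ p * τ := by
  have hp0 : 0 < p := by linarith
  have tail : ∀ z : lp X (ENNReal.ofReal p),
      HasSum (fun i => ‖z (i + N)‖ ^ p) (‖z‖ ^ p - headEnergy p z N) := fun z =>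
    (hasSum_nat_add_iff' N).2 (hasSum_rpow_norm hp0 z)
  have h := hasSum_le (fun i => rpow_norm_sub_le hp (x (i + N)) (y (i + N))) (tail (x - y))
    (((tail x).add (tail y)).mul_left (2 ^ (p - 1)))
  have h2 : (2 : ℝ) ^ p = 2 ^ (p - 1) * 2 := by
    rw [← Real.rpow_add_one two_ne_zero, sub_add_cancel]
  have h3 : (2 : ℝ) ^ (p - 1) * (‖x‖ ^ p - headEnergy p x N + (‖y‖ ^ p - headEnergy p y N)) ≤
      2 ^ (p - 1) * (2 * τ) := by
    gcongr
    linarith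
  rw [h2]
  linarith

variable [Fact (1 ≤ ENNReal.ofReal p)]

/-- On a suitable infinite set, the variation of `f` splits into uniform variations of finitely
many coordinates and a uniformly bounded tail. -/
theorem exists_infinite_head_tail_bounds (hp : 1 < p) {k : ℕ}
    {f : IncTuple k → lp X (ENNReal.ofReal p)} (hf : Bornology.IsBounded (Set.range f)) {ε : ℝ}
    (hε : 0 < ε) :
    ∃ (N : ℕ) (τ : ℝ) (c : ℕ → Fin k → ℝ) (M : Set ℕ), M.Infinite ∧ (∀ i j, 0 ≤ c i j) ∧
      τ + ∑ i ∈ Finset.range N, ∑ j, c i j ≤ ∑ j, dirLip f j ^ p + ε ∧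
      (∀ n ∈ incTuplesIn M k, ‖f n‖ ^ p - headEnergy p (f n) N ≤ τ) ∧
      ∀ i < N, ∀ j n m, (n, m) ∈ directionPairs M j → ‖f n i - f m i‖ ^ p ≤ c i j := by
  classical
  have hp0 : 0 < p := by linarith
  obtain ⟨B, hB⟩ := isBounded_iff_forall_norm_le.1 hf
  -- The iterated ultrafilter lives on all tuples, so `f` is extended by 0; almost all tuples are
  -- increasing.
  let g : (Fin k → ℕ) → lp X (ENNReal.ofReal p) := fun n => if h : StrictMono n then f ⟨n, h⟩ else 0
  have hgf : ∀ {n : Fin k → ℕ} (h : StrictMono n), g n = f ⟨n, h⟩ := fun h => dif_pos h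
  have hgB : ∀ n, ‖g n‖ ≤ |B| := fun n => by
    by_cases h : StrictMono n
    · rw [hgf h]; exact (hB _ ⟨_, rfl⟩).trans (le_abs_self B)
    · simp [g, h]
  have hdB : ∀ n m, ‖g n - g m‖ ≤ 2 * |B| := fun n m =>
    (norm_sub_le _ _).trans (by linarith [hgB n, hgB m])
  set C := (2 * |B|) ^ p
  have hbd : ∀ x : lp X (ENNReal.ofReal p), ‖x‖ ≤ 2 * |B| → ‖x‖ ^ p ≤ C := fun x hx =>
    Real.rpow_le_rpow (norm_nonneg _) hx hp0.le
  have hgC : ∀ n, ‖g n‖ ^ p ≤ C := fun n => hbd _ (by linarith [hgB n, abs_nonneg B])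
  have hdC : ∀ n m, ‖g n - g m‖ ^ p ≤ C := fun n m => hbd _ (hdB n m)
  have e1 : ∀ n N, headEnergy p (g n) N ≤ C := fun n N =>
    (headEnergy_le_rpow_norm hp0 _ N).trans (hgC n)
  have e2 : ∀ n m N, headEnergy p (fun i => g n i - g m i) N ≤ C := fun n m N =>
    (headEnergy_le_rpow_norm hp0 (g n - g m) N).trans (hdC n m)
  let v : ℕ → Fin k → (Fin (k + 1) → ℕ) → ℝ := fun i j t =>
    ‖g (j.succ.removeNth t) i - g (j.castSucc.removeNth t) i‖ ^ p
  have hv : ∀ i j t, v i j t ∈ Set.Icc 0 C := fun i j t =>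
    ⟨Real.rpow_nonneg (norm_nonneg _) _, (Finset.single_le_sum
      (f := fun i => v i j t) (fun _ _ => Real.rpow_nonneg (norm_nonneg _) _)
      (Finset.mem_range.2 i.lt_succ_self)).trans (e2 _ _ (i + 1))⟩
  have hvar : ∀ N j, ultraLim (iterHyper (k + 1)) (variationEnergy p (fun n => g n) j N) =
      ∑ i ∈ Finset.range N, ultraLim (iterHyper (k + 1)) (v i j) := fun N j => by
    have h : Tendsto (variationEnergy p (fun n => g n) j N) (iterHyper (k + 1))
        (𝓝 (∑ i ∈ Finset.range N, ultraLim (iterHyper (k + 1)) (v i j))) :=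
      tendsto_finsetSum _ fun i _ => tendsto_ultraLim (hv i j)
    exact h.limUnder_eq
  have hK : ∀ j, ∀ᶠ t : Fin (k + 1) → ℕ in iterHyper (k + 1), ∀ N,
      variationEnergy p (fun n => g n) j N t ≤ dirLip f j ^ p := fun j => by
    filter_upwards [eventually_strictMono (k + 1)] with t ht N
    refine (headEnergy_le_rpow_norm hp0
      (g (j.succ.removeNth t) - g (j.castSucc.removeNth t)) N).trans ?_
    have hm : ∀ i : Fin (k + 1), StrictMono (i.removeNth t) := fun i =>
      ht.comp (Fin.strictMono_succAbove i)
    rw [hgf (hm _), hgf (hm _), ← dist_eq_norm]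
    exact Real.rpow_le_rpow dist_nonneg (dist_le_dirLip hf (removeNth_mem_directionPairs j ht)) hp0.le
  obtain ⟨N, -, hN⟩ := exists_stableEnergy_lt_ultraLim (V := iterHyper k) (f := fun n => g n) e1
    (show 0 < ε / 3 by positivity) 0
  have hmain := totalEnergy_sub_stableEnergy_add_le hp (f := fun n => g n) e1 e2 hK N
  simp only [hvar, totalEnergy_eq_rpow_norm hp0] at hmain
  rw [Finset.sum_comm] at hmain
  have hg0 : ∀ n, ‖g n‖ ^ p ∈ Set.Icc 0 C := fun n => ⟨Real.rpow_nonneg (norm_nonneg _) _, hgC n⟩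
  have hh0 : ∀ n, headEnergy p (g n) N ∈ Set.Icc 0 C := fun n => ⟨headEnergy_nonneg _ _, e1 n N⟩
  -- One third of ε pays for the `N * k` variation bounds, the others for the choice of `N` and for
  -- `q1`. The `+ 1` keeps the denominator positive.
  set η := ε / (3 * (N * k + 1))
  have hη : 0 < η := by positivity
  have hηN : N * (k * η) ≤ ε / 3 := by
    have : (N * k + 1) * η = ε / 3 := by
      simp only [η]
      field_simp
    nlinarith
  have q1 : ∀ᶠ n : Fin k → ℕ in iterHyper k, ‖g n‖ ^ p - headEnergy p (g n) N <
      (ultraLim (iterHyper k) (fun n => ‖g n‖ ^ p) -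
        ultraLim (iterHyper k) fun n => headEnergy p (g n) N) + ε / 3 :=
    ((tendsto_ultraLim hg0).sub (tendsto_ultraLim hh0)).eventually_lt_const (by linarith)
  have q2 : ∀ᶠ t : Fin (k + 1) → ℕ in iterHyper (k + 1), ∀ i ∈ Finset.range N, ∀ j,
      v i j t < ultraLim (iterHyper (k + 1)) (v i j) + η :=
    (Filter.eventually_all_finset _).2 fun i _ => eventually_all.2 fun j =>
      eventually_lt_ultraLim_add (hv i j) hη
  obtain ⟨M, hM, hQ⟩ := exists_infinite_forall_of_eventually ((eventually_init q1).and q2)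
  refine ⟨N, (ultraLim (iterHyper k) (fun n => ‖g n‖ ^ p) -
    ultraLim (iterHyper k) fun n => headEnergy p (g n) N) + ε / 3, fun i j => ultraLim (iterHyper (k + 1)) (v i j) + η, M, hM,
    fun i j => add_nonneg (ultraLim_mem_Icc (hv i j)).1 hη.le, ?_, fun n hn => ?_, ?_⟩
  · simp only [Finset.sum_add_distrib, Finset.sum_const, Finset.card_univ, Fintype.card_fin,
      Finset.card_range, nsmul_eq_mul]
    linarith
  -- The extraction concerns `(k + 1)`-tuples, so `n` is extended by a larger element of `M`.
  · obtain ⟨a, haM, ha⟩ := hM.exists_gt (Finset.univ.sup n.1)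
    have hmono : StrictMono (Fin.snoc n.1 a : Fin (k + 1) → ℕ) := by
      rw [← Fin.insertNth_last', Fin.strictMono_insertNth_iff]
      exact ⟨n.2, fun i _ => (Finset.le_sup (Finset.mem_univ i)).trans_lt ha,
        fun i hi => absurd hi (Fin.castSucc_lt_last i).not_ge⟩
    have := (hQ (Fin.snoc n.1 a) hmono fun i => by
      induction i using Fin.lastCases with
      | last => simpa using haM
      | cast i => simpa using hn i).1
    simp only [Fin.snoc_castSucc, hgf n.2] at this
    exact this.le
  · intro i hi j n m hnm
    obtain ⟨t, ht, htM, h1, h2⟩ := exists_removeNth_eq_of_mem_directionPairs hnm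
    have := (hQ t ht htM).2 i (Finset.mem_range.2 hi) j
    simp only [v, h1, h2, hgf n.2, hgf m.2] at this
    exact this.le

theorem isBounded_range_coord (hp : 0 < p) {S : Type*} {f : S → lp X (ENNReal.ofReal p)}
    (hf : Bornology.IsBounded (Set.range f)) (i : ℕ) :
    Bornology.IsBounded (Set.range fun s => f s i) := by
  obtain ⟨B, hB⟩ := isBounded_iff_forall_norm_le.1 hf
  refine isBounded_iff_forall_norm_le.2 ⟨B, ?_⟩
  rintro _ ⟨s, rfl⟩
  exact (lp.norm_apply_le_norm (ENNReal.ofReal_pos.2 hp).ne' (f s) i).trans (hB _ ⟨s, rfl⟩)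

variable {R : ∀ k, IncTuple k → IncTuple k → Prop} {lam : ℝ}

theorem exists_infinite_rpow_norm_sub_le (hR : IsReindexInvariant R) (hp : 1 < p) (hlam : 2 ≤ lam)
    (hX : ∀ n, HasConcentration R lam p (X n)) {k : ℕ} {f : IncTuple k → lp X (ENNReal.ofReal p)}
    (hf : Bornology.IsBounded (Set.range f)) {ε : ℝ} (hε : 0 < ε) :
    ∃ M : Set ℕ, M.Infinite ∧ ∀ n ∈ incTuplesIn M k, ∀ m ∈ incTuplesIn M k, R k n m →
      ‖f n - f m‖ ^ p ≤ lam ^ p * (∑ j, dirLip f j ^ p + ε) := by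
  have hp0 : 0 < p := by linarith
  have hlam0 : 0 ≤ lam := by linarith
  obtain ⟨N, τ, c, M, hM, hc, hsum, htail, hhead⟩ := exists_infinite_head_tail_bounds hp hf hε
  -- The set is thinned once per coordinate `i < N`, using concentration in X_i with the bounds `c i
  -- j ^ (1 / p)`.
  have refine_coords : ∀ N' ≤ N, ∃ M' ⊆ M, M'.Infinite ∧ ∀ i < N', ∀ n ∈ incTuplesIn M' k,
      ∀ m ∈ incTuplesIn M' k, R k n m → ‖f n i - f m i‖ ^ p ≤ lam ^ p * ∑ j, c i j := by
    intro N'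
    induction N' with
    | zero => exact fun _ => ⟨M, subset_rfl, hM, fun i hi => absurd hi (Nat.not_lt_zero i)⟩
    | succ r ih =>
      intro hr
      obtain ⟨M₁, hM₁M, hM₁, h₁⟩ := ih (by omega)
      obtain ⟨M₂, hM₂M, hM₂, h₂⟩ := (hX r).exists_infinite_subset hR hlam0 hp0
        (isBounded_range_coord hp0 hf r) hM₁ (b := fun j => c r j ^ (1 / p))
        (fun j => Real.rpow_nonneg (hc r j) _) fun j n m hnm => by
          have := hhead r (by omega) j n m ⟨fun i => hM₁M (hnm.1 i), fun i => hM₁M (hnm.2.1 i),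
            hnm.2.2⟩
          rw [dist_eq_norm, one_div]
          exact (Real.le_rpow_inv_iff_of_pos (norm_nonneg _) (hc r j) hp0).2 this
      refine ⟨M₂, hM₂M.trans hM₁M, hM₂, fun i hi n hn m hm hnm => ?_⟩
      rcases Nat.lt_succ_iff_lt_or_eq.1 hi with hi | rfl
      · exact h₁ i hi n (fun l => hM₂M (hn l)) m (fun l => hM₂M (hm l)) hnm
      · have := Real.rpow_le_rpow dist_nonneg (h₂ n hn m hm hnm) hp0.le
        simp only [dist_eq_norm, one_div, Real.rpow_inv_rpow (hc i _) hp0.ne'] at this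
        have hs : 0 ≤ ∑ j, c i j := Finset.sum_nonneg fun j _ => hc i j
        rwa [Real.mul_rpow hlam0 (Real.rpow_nonneg hs _), Real.rpow_inv_rpow hs hp0.ne'] at this
  obtain ⟨M', hM'M, hM', h⟩ := refine_coords N le_rfl
  refine ⟨M', hM', fun n hn m hm hnm => ?_⟩
  have hτn := htail n fun l => hM'M (hn l)
  have hτ : 0 ≤ τ := (sub_nonneg.2 (headEnergy_le_rpow_norm hp0 (f n) N)).trans hτn
  calc ‖f n - f m‖ ^ p
      ≤ headEnergy p (f n - f m : lp X (ENNReal.ofReal p)) N + 2 ^ p * τ :=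
        rpow_norm_sub_le_headEnergy_add hp.le _ _ N hτn (htail m fun l => hM'M (hm l))
    _ ≤ ∑ i ∈ Finset.range N, lam ^ p * ∑ j, c i j + lam ^ p * τ := by
        refine add_le_add (Finset.sum_le_sum fun i hi => ?_) ?_
        · exact h i (Finset.mem_range.1 hi) n hn m hm hnm
        -- This is where λ ≥ 2 enters: the triangle inequality on the tail costs 2^p.
        · exact mul_le_mul_of_nonneg_right (Real.rpow_le_rpow zero_le_two hlam hp0.le) hτ
    _ = lam ^ p * (τ + ∑ i ∈ Finset.range N, ∑ j, c i j) := by rw [← Finset.mul_sum]; ring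
    _ ≤ _ := mul_le_mul_of_nonneg_left hsum (Real.rpow_nonneg hlam0 _)

theorem HasConcentration.lpSum (hR : IsReindexInvariant R) (hp : 1 < p) (hlam : 2 ≤ lam)
    (hX : ∀ n, HasConcentration R lam p (X n)) {ε : ℝ} (hε : 0 < ε) :
    HasConcentration R (lam + ε) p (lp X (ENNReal.ofReal p)) := by
  intro k f hf
  have hp0 : 0 < p := by linarith
  have hterm : ∀ j, 0 ≤ dirLip f j ^ p := fun j => Real.rpow_nonneg (dirLip_nonneg f j) _
  have hS0 : 0 ≤ ∑ j, dirLip f j ^ p := Finset.sum_nonneg fun j _ => hterm j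
  -- An additive error can be absorbed into the factor λ + ε only if S > 0; if S = 0, then `f` is
  -- constant.
  rcases hS0.eq_or_lt with hS | hS
  · have hz : ∀ j, dirLip f j = 0 := fun j => (Real.rpow_eq_zero (dirLip_nonneg f j) hp0.ne').1
      ((Finset.sum_eq_zero_iff_of_nonneg fun j _ => hterm j).1 hS.symm j (Finset.mem_univ j))
    refine ⟨Set.univ, Set.infinite_univ, fun n _ m _ _ => ?_⟩
    rw [eq_of_forall_dirLip_eq_zero hf hz n m, dist_self]
    exact mul_nonneg (by linarith) (Real.rpow_nonneg hS0 _)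
  · set S := ∑ j, dirLip f j ^ p
    have hlp : 0 < lam ^ p := Real.rpow_pos_of_pos (by linarith) _
    have hlt : lam ^ p < (lam + ε) ^ p := Real.rpow_lt_rpow (by linarith) (by linarith) hp0
    obtain ⟨M, hM, h⟩ := exists_infinite_rpow_norm_sub_le hR hp hlam hX hf
      -- Chosen so that λ^p (S + error) = (λ + ε)^p S.
      (ε := ((lam + ε) ^ p - lam ^ p) * S / lam ^ p)
      (div_pos (mul_pos (sub_pos.2 hlt) hS) hlp)
    refine ⟨M, hM, fun n hn m hm hnm => ?_⟩
    rw [dist_eq_norm, ← Real.rpow_le_rpow_iff (norm_nonneg _)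
      (mul_nonneg (by linarith) (Real.rpow_nonneg hS0 _)) hp0,
      Real.mul_rpow (by linarith) (Real.rpow_nonneg hS0 _), one_div,
      Real.rpow_inv_rpow hS0 hp0.ne']
    refine (h n hn m hm hnm).trans_eq ?_
    field_simp
    ring

end lpSum

theorem theorem1p2 (p : ℝ) (hp : 1 < p) [Fact (1 ≤ ENNReal.ofReal p)]
    (lam : ℝ) (hlam : 2 ≤ lam)
    (X : ℕ → Type*) [∀ n, NormedAddCommGroup (X n)] [∀ n, NormedSpace ℝ (X n)]
    [∀ n, CompleteSpace (X n)] :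
    ((∀ n, HasHFC lam p (X n)) →
      ∀ ε : ℝ, 0 < ε → HasHFC (lam + ε) p (lp X (ENNReal.ofReal p))) ∧
    ((∀ n, HasHIC lam p (X n)) →
      ∀ ε : ℝ, 0 < ε → HasHIC (lam + ε) p (lp X (ENNReal.ofReal p))) := by
  simp only [hasHFC_iff_hasConcentration, hasHIC_iff_hasConcentration]
  exact ⟨fun hX ε hε => HasConcentration.lpSum (fun _ _ _ _ _ _ => trivial) hp hlam hX hε,
    fun hX ε hε => HasConcentration.lpSum isReindexInvariant_interlaced hp hlam hX hε⟩
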